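/- A signed graph $\Gamma=(G,\sigma)$ consists of a finite simple graph $G$ and a map $\sigma:E(G)\to\{+1,-1\}$; its adjacency matrix has $(u,v)$ entry $\sigma(uv)$ if $uv\in E(G)$ and $0$ otherwise, and its index $\lambda_1(\Gamma)$ is the largest eigenvalue of this matrix. A cycle of $\Gamma$ is negative if the product of the signs of its edges is $-1$, and $\Gamma$ is unbalanced if it contains a negative cycle. Two signed graphs are switching equivalent if, up to an isomorphism of the underlying graphs, one is obtained from the other by reversing the signs of all edges between a set $U$ of vertices and its complement. For $n\ge 3$ let $\Gamma_1=C_3^-\bullet K_{n-2}$ be the signed graph of order $n$ obtained from the complete graph $K_{n-2}$ with all edges positive and a triangle $C_3^-$ with exactly one negative edge by identifying a vertex of $K_{n-2}$ with the vertex of $C_3^-$ whose two incident edges in $C_3^-$ are positive. Theorem. Let $\Gamma$ be an unbalanced signed graph of order $n$ and let $r$ be an integer with $4\le r\le\lfloor n/3\rfloor+1$. If $\lambda_1(\Gamma)\ge\lambda_1(\Gamma_1)$, then $\Gamma$ contains a negative cycle of length $r$, unless $\Gamma$ is switching equivalent to $\Gamma_1$. -/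

import Mathlib

/-- A signed graph `(G, σ)`: a simple graph `G` together with a sign `+1` or `-1` on each edge. -/
structure SignedGraph (V : Type*) where
  graph : SimpleGraph V
  sign : graph.edgeSet → ℤˣ

namespace SignedGraph

/-- The sign of a walk: the product of the signs of the edges it traverses. -/
def walkSign {V : Type*} (Γ : SignedGraph V) {u v : V} (p : Γ.graph.Walk u v) : ℤˣ :=
  (p.darts.map fun d => Γ.sign ⟨d.edge, d.edge_mem⟩).prod

/-- `Γ` contains a negative cycle of length `r`. -/
def HasNegativeCycle {V : Type*} (Γ : SignedGraph V) (r : ℕ) : Prop :=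
  ∃ (v : V) (p : Γ.graph.Walk v v), p.IsCycle ∧ p.length = r ∧ Γ.walkSign p = -1

/-- A signed graph is balanced if every cycle is positive. -/
def IsBalanced {V : Type*} (Γ : SignedGraph V) : Prop :=
  ∀ (v : V) (p : Γ.graph.Walk v v), p.IsCycle → Γ.walkSign p = 1

open Classical in
/-- The adjacency matrix: entry `σ(uv)` if `uv` is an edge, and `0` otherwise. -/
noncomputable def adjMatrix {V : Type*} (Γ : SignedGraph V) : Matrix V V ℝ :=
  Matrix.of fun u v =>
    if h : Γ.graph.Adj u v then (((Γ.sign ⟨s(u, v), h⟩ : ℤˣ) : ℤ) : ℝ) else 0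

/-- The index `λ₁(Γ)`, the largest eigenvalue of the adjacency matrix. The spectrum of this real
symmetric matrix is finite, and nonempty if `V` is nonempty, so that the supremum is a maximum. -/
noncomputable def index {V : Type*} [Fintype V] [DecidableEq V] (Γ : SignedGraph V) : ℝ :=
  sSup (spectrum ℝ Γ.adjMatrix)

theorem adjMatrix_isHermitian {V : Type*} (Γ : SignedGraph V) : Γ.adjMatrix.IsHermitian := by
  ext u v
  simp only [adjMatrix, Matrix.conjTranspose_apply, Matrix.of_apply, star_trivial,
    Sym2.eq_swap (a := v) (b := u)]
  by_cases h : Γ.graph.Adj u v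
  · simp [h, h.symm]
  · have h' : ¬ Γ.graph.Adj v u := fun k => h k.symm
    simp [h, h']

theorem index_isGreatest {V : Type*} [Fintype V] [DecidableEq V] [Nonempty V]
    (Γ : SignedGraph V) : IsGreatest (spectrum ℝ Γ.adjMatrix) Γ.index := by
  have h := Γ.adjMatrix_isHermitian.spectrum_real_eq_range_eigenvalues
  have hf : (spectrum ℝ Γ.adjMatrix).Finite := h ▸ Set.finite_range _
  have hne : (spectrum ℝ Γ.adjMatrix).Nonempty := h ▸ Set.range_nonempty _
  exact ⟨hne.csSup_mem hf, fun x hx => le_csSup hf.bddAbove hx⟩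

/-- Switching equivalence of signed graphs, possibly on different vertex sets: up to an isomorphism
`e` of the underlying graphs, the signs of `Γ'` arise from those of `Γ` by reversing the signs of
the edges between `{u | θ u = 1}` and `{u | θ u = -1}`. -/
def SwitchingEquivalent {V W : Type*} (Γ : SignedGraph V) (Γ' : SignedGraph W) : Prop :=
  ∃ (e : Γ.graph ≃g Γ'.graph) (θ : V → ℤˣ), ∀ (u v : V) (h : Γ.graph.Adj u v),
    Γ'.sign ⟨s(e u, e v), e.map_adj_iff.mpr h⟩ = θ u * Γ.sign ⟨s(u, v), h⟩ * θ v

/-- The signed graph `C₃⁻ • K_{n-2}` of order `n` (for `n ≥ 3`): the triangle has vertices `0, 1, 2`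
and its only negative edge is `01`; the complete graph `K_{n-2}` has vertices `2, …, n - 1`
and all of its edges are positive. -/
def triangleClique (n : ℕ) : SignedGraph (Fin n) where
  graph :=
    { Adj := fun i j => i ≠ j ∧ ((i.val ≤ 2 ∧ j.val ≤ 2) ∨ (2 ≤ i.val ∧ 2 ≤ j.val))
      symm := ⟨fun _ _ h => ⟨h.1.symm, h.2.imp And.symm And.symm⟩⟩
      loopless := ⟨fun _ h => h.1 rfl⟩ }
  sign := fun e => if (e : Sym2 (Fin n)).map Fin.val = s(0, 1) then -1 else 1

end SignedGraph

/-!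
The index of `C₃⁻ • K_{n-2}` exceeds `n - 3`, because the positive clique `K_{n-2}` has the
eigenvalue `n - 3`, with an eigenvector whose extension by zero is not an eigenvector. After a
switching, `λ₁(Γ)` has an eigenvector `x ≥ 0` whose largest entry is `x w = 1`. The eigenvalue
equation at `w` then says that the vertices together fall short by less than `2` of being neighbours
of `w` along positive edges with entry `1`.

Let `uv` be a negative edge; it exists because `Γ` is unbalanced. A path of positive edges of length
`r - 1` from `u` to `v` closes up with `uv` to a negative cycle of length `r`. Such a path is built
through `w`, backwards from a heavy neighbour of `u` or `v`: as `λ₁(Γ) ≥ 2 (r - 1)`, the eigenvalue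
equation at the current heavy vertex produces a further unused heavy neighbour. The construction
fails only if `w` is the only neighbour of `u` and of `v` along positive edges. In that case the
adjacency matrix is bounded entrywise by that of `C₃⁻ • K_{n-2}`, and since `λ₁(Γ)` is
not smaller, Perron-Frobenius theory forces the two matrices to be equal.
-/

section Spectral

open Matrix
open scoped MatrixOrder

variable {ι : Type*} [Fintype ι] {A B : Matrix ι ι ℝ} {μ t : ℝ} {y z : ι → ℝ}

theorem mulVec_le_mulVec_of_le (hBA : ∀ i j, B i j ≤ A i j) (hz : 0 ≤ z) : B *ᵥ z ≤ A *ᵥ z :=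
  fun i => Finset.sum_le_sum fun j _ => mul_le_mul_of_nonneg_right (hBA i j) (hz j)

theorem eq_of_le_of_mulVec_eq (hBA : ∀ i j, B i j ≤ A i j) (hz : ∀ i, 0 < z i)
    (h : B *ᵥ z = A *ᵥ z) : B = A := by
  ext i j
  have hle : ∀ k ∈ Finset.univ, B i k * z k ≤ A i k * z k := fun k _ =>
    mul_le_mul_of_nonneg_right (hBA i k) (hz k).le
  have hentry := (Finset.sum_eq_sum_iff_of_le hle).mp (congrFun h i) j (Finset.mem_univ j)
  exact mul_right_cancel₀ (hz j).ne' hentry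

variable [DecidableEq ι]

theorem algebraMap_sub_mulVec (A : Matrix ι ι ℝ) (μ : ℝ) (y : ι → ℝ) :
    (algebraMap ℝ (Matrix ι ι ℝ) μ - A) *ᵥ y = μ • y - A *ᵥ y := by
  rw [sub_mulVec, Algebra.algebraMap_eq_smul_one, smul_mulVec, one_mulVec]

theorem posSemidef_algebraMap_sub (hA : A.IsHermitian) (hμ : μ ∈ upperBounds (spectrum ℝ A)) :
    (algebraMap ℝ (Matrix ι ι ℝ) μ - A).PosSemidef :=
  Matrix.le_iff.mp ((le_algebraMap_iff_spectrum_le hA.isSelfAdjoint).mpr hμ)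

theorem dotProduct_mulVec_le (hA : A.IsHermitian) (hμ : μ ∈ upperBounds (spectrum ℝ A))
    (y : ι → ℝ) : y ⬝ᵥ A *ᵥ y ≤ μ * (y ⬝ᵥ y) := by
  have h := (posSemidef_algebraMap_sub hA hμ).dotProduct_mulVec_nonneg y
  rwa [algebraMap_sub_mulVec, star_trivial, dotProduct_sub, dotProduct_smul, smul_eq_mul,
    sub_nonneg] at h

theorem mulVec_eq_smul_of_le_dotProduct (hA : A.IsHermitian)
    (hμ : μ ∈ upperBounds (spectrum ℝ A)) (hy : μ * (y ⬝ᵥ y) ≤ y ⬝ᵥ A *ᵥ y) :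
    A *ᵥ y = μ • y := by
  have hzero : y ⬝ᵥ (algebraMap ℝ (Matrix ι ι ℝ) μ - A) *ᵥ y = 0 := by
    rw [algebraMap_sub_mulVec, dotProduct_sub, dotProduct_smul, smul_eq_mul, sub_eq_zero]
    exact le_antisymm hy (dotProduct_mulVec_le hA hμ y)
  have h := ((posSemidef_algebraMap_sub hA hμ).dotProduct_mulVec_zero_iff y).mp hzero
  rw [algebraMap_sub_mulVec, sub_eq_zero] at h
  exact h.symm

theorem lt_of_le_dotProduct_of_mulVec_ne (hA : A.IsHermitian)
    (hμ : μ ∈ upperBounds (spectrum ℝ A)) (hy : t * (y ⬝ᵥ y) ≤ y ⬝ᵥ A *ᵥ y)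
    (hne : A *ᵥ y ≠ t • y) : t < μ := by
  by_contra! hle
  have hnonneg : 0 ≤ y ⬝ᵥ y := Finset.sum_nonneg fun i _ => mul_self_nonneg (y i)
  have heig := mulVec_eq_smul_of_le_dotProduct hA hμ
    ((mul_le_mul_of_nonneg_right hle hnonneg).trans hy)
  have hpos : 0 < y ⬝ᵥ y := hnonneg.lt_of_ne' fun h0 => hne <| by
    simp [dotProduct_self_eq_zero.mp h0]
  rw [heig, dotProduct_smul, smul_eq_mul] at hy
  exact hne (heig.trans (by rw [hle.antisymm (le_of_mul_le_mul_right hy hpos)]))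

theorem mulVec_eq_smul_of_dominated (hA : A.IsHermitian) (hμ : μ ∈ upperBounds (spectrum ℝ A))
    (hBA : ∀ i j, B i j ≤ A i j) (hz : 0 ≤ z) (hB : B *ᵥ z = t • z) (hμt : μ ≤ t) :
    A *ᵥ z = t • z := by
  have hquad : t * (z ⬝ᵥ z) ≤ z ⬝ᵥ A *ᵥ z := by
    rw [← smul_eq_mul, ← dotProduct_smul, ← hB]
    exact dotProduct_le_dotProduct_of_nonneg_left (mulVec_le_mulVec_of_le hBA hz) hz
  by_contra hne
  exact (lt_of_le_dotProduct_of_mulVec_ne hA hμ hquad hne).not_ge hμt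

theorem exists_mulVec_eq_smul (hμ : μ ∈ spectrum ℝ A) : ∃ y ≠ 0, A *ᵥ y = μ • y := by
  rw [spectrum.mem_iff, isUnit_iff_isUnit_det, isUnit_iff_ne_zero, not_not] at hμ
  obtain ⟨y, hy, h⟩ := exists_mulVec_eq_zero_iff.mpr hμ
  rw [algebraMap_sub_mulVec, sub_eq_zero] at h
  exact ⟨y, hy, h.symm⟩

end Spectral

/-- A subeigenvector `x ≥ 0` of the adjacency matrix of `G`, for a value `lam` larger than `n - 3`,
normalised to have its largest entry `x w = 1` at the vertex `w`. -/
structure IsLargeSubeigenvector {V : Type*} [Fintype V] (G : SimpleGraph V) (x : V → ℝ) (lam : ℝ)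
    (w : V) : Prop where
  nonneg : ∀ i, 0 ≤ x i
  le_one : ∀ i, x i ≤ 1
  eq_one : x w = 1
  lt_lam : (Fintype.card V : ℝ) - 3 < lam
  le_sum : ∀ i, lam * x i ≤ ∑ j, (G.neighborSet i).indicator x j

/-- The inequalities that a negative edge `uv` imposes on a nonnegative eigenvector `x` of a signed
graph, expressed in terms of the graph `G` of positive edges. -/
structure IsNegativePair {V : Type*} [Fintype V] (G : SimpleGraph V) (x : V → ℝ) (lam : ℝ)
    (u v : V) : Prop where
  ne : u ≠ v
  not_adj : ¬ G.Adj u v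
  le_left : lam * x u + x v ≤ ∑ j, (G.neighborSet u).indicator x j
  le_right : lam * x v + x u ≤ ∑ j, (G.neighborSet v).indicator x j

theorem IsNegativePair.symm {V : Type*} [Fintype V] {G : SimpleGraph V} {x : V → ℝ} {lam : ℝ}
    {u v : V} (h : IsNegativePair G x lam u v) : IsNegativePair G x lam v u :=
  ⟨h.ne.symm, fun hvu => h.not_adj hvu.symm, h.le_right, h.le_left⟩

namespace IsLargeSubeigenvector

open Finset

variable {V : Type*} {G : SimpleGraph V} {x : V → ℝ} {lam : ℝ} {u v w b z : V}

/-- The amount by which `z` falls short of being a neighbour of `w` (or `w` itself) of weight `1`.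
All defects together are less than `2`, so that `w` has few non-neighbours and few neighbours of
small weight. -/
noncomputable def defect (G : SimpleGraph V) (x : V → ℝ) (w z : V) : ℝ :=
  1 - (insert w (G.neighborSet w)).indicator x z

/-- `z` is `w` or a neighbour of `w`, and has weight larger than `1 / 2`. -/
def IsHeavy (G : SimpleGraph V) (x : V → ℝ) (w z : V) : Prop :=
  z ∈ insert w (G.neighborSet w) ∧ 1 / 2 < x z

theorem defect_of_mem (hz : z ∈ insert w (G.neighborSet w)) : defect G x w z = 1 - x z := by
  rw [defect, Set.indicator_of_mem hz]

theorem defect_of_notMem (hz : z ∉ insert w (G.neighborSet w)) : defect G x w z = 1 := by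
  rw [defect, Set.indicator_of_notMem hz, sub_zero]

variable [Fintype V]

theorem defect_nonneg (h : IsLargeSubeigenvector G x lam w) (z : V) : 0 ≤ defect G x w z :=
  sub_nonneg.mpr (Set.indicator_apply_le' (fun _ => h.le_one z) fun _ => zero_le_one)

theorem one_sub_le_defect (h : IsLargeSubeigenvector G x lam w) (z : V) :
    1 - x z ≤ defect G x w z :=
  sub_le_sub_left (Set.indicator_le_self' (fun _ _ => h.nonneg z) z) 1

theorem le_defect_of_not_isHeavy (h : IsLargeSubeigenvector G x lam w)
    (hz : ¬ IsHeavy G x w z) : x z ≤ defect G x w z := by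
  by_cases hmem : z ∈ insert w (G.neighborSet w)
  · have hlight : x z ≤ 1 / 2 := not_lt.mp fun hlt => hz ⟨hmem, hlt⟩
    rw [defect_of_mem hmem]
    linarith
  · exact (h.le_one z).trans_eq (defect_of_notMem hmem).symm

theorem half_le_defect_of_not_isHeavy (h : IsLargeSubeigenvector G x lam w)
    (hz : ¬ IsHeavy G x w z) : 1 / 2 ≤ defect G x w z := by
  linarith [h.le_defect_of_not_isHeavy hz, h.one_sub_le_defect z]

theorem sum_defect_lt_two (h : IsLargeSubeigenvector G x lam w) (T : Finset V) :
    ∑ z ∈ T, defect G x w z < 2 := by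
  classical
  have hindicator : (insert w (G.neighborSet w)).indicator x =
      Pi.single w (x w) + (G.neighborSet w).indicator x := by
    rw [Set.insert_eq, Set.indicator_union_of_disjoint (by simp), Set.indicator_singleton]
    rfl
  have htotal : ∑ z, (insert w (G.neighborSet w)).indicator x z =
      1 + ∑ z, (G.neighborSet w).indicator x z := by
    simp [hindicator, sum_add_distrib, h.eq_one]
  calc ∑ z ∈ T, defect G x w z
      ≤ ∑ z, defect G x w z :=
        sum_le_sum_of_subset_of_nonneg (subset_univ T) fun z _ _ => h.defect_nonneg z
    _ = Fintype.card V - (1 + ∑ z, (G.neighborSet w).indicator x z) := by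
        simp [defect, htotal]
    _ < 2 := by
        have hrow := h.le_sum w
        rw [h.eq_one, mul_one] at hrow
        linarith [h.lt_lam]

theorem sum_notMem_le_one (h : IsLargeSubeigenvector G x lam w) {S : Finset V}
    (hS : ∀ z ∈ S, z ∉ insert w (G.neighborSet w)) : ∑ z ∈ S, x z ≤ 1 := by
  have hcard : (#S : ℝ) < 2 := by
    have hdefect := h.sum_defect_lt_two S
    rwa [sum_congr rfl fun z hz => defect_of_notMem (hS z hz), sum_const, nsmul_one] at hdefect
  have hcard' : (#S : ℝ) ≤ 1 := by
    norm_cast at hcard ⊢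
    omega
  calc ∑ z ∈ S, x z ≤ ∑ _z ∈ S, (1 : ℝ) := sum_le_sum fun z _ => h.le_one z
    _ ≤ 1 := by simpa using hcard'

-- Rounding the defect of each light vertex down to `1 / 2` or `1` gains over the bound `2`.
theorem sum_light_le (h : IsLargeSubeigenvector G x lam w) {S : Finset V}
    (hS : ∀ z ∈ S, ¬ IsHeavy G x w z) : ∑ z ∈ S, x z ≤ 3 / 2 := by
  classical
  set halves : V → ℕ := fun z => if z ∈ insert w (G.neighborSet w) then 1 else 2
  have hbounds : ∀ z ∈ S, x z ≤ (halves z : ℝ) / 2 ∧ (halves z : ℝ) / 2 ≤ defect G x w z := by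
    intro z hz
    by_cases hmem : z ∈ insert w (G.neighborSet w)
    · rw [show halves z = 1 from if_pos hmem, Nat.cast_one]
      exact ⟨not_lt.mp fun hlt => hS z hz ⟨hmem, hlt⟩, h.half_le_defect_of_not_isHeavy (hS z hz)⟩
    · rw [show halves z = 2 from if_neg hmem, Nat.cast_two, div_self two_ne_zero]
      exact ⟨h.le_one z, (defect_of_notMem hmem).ge⟩
  have hlt : (∑ z ∈ S, halves z : ℕ) < 2 * 2 := by
    have hsum := (sum_le_sum fun z hz => (hbounds z hz).2).trans_lt (h.sum_defect_lt_two S)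
    rw [← sum_div, div_lt_iff₀ two_pos] at hsum
    exact_mod_cast hsum
  calc ∑ z ∈ S, x z ≤ (∑ z ∈ S, halves z : ℕ) / 2 := by
        push_cast [sum_div]
        exact sum_le_sum fun z hz => (hbounds z hz).1
    _ ≤ 3 / 2 := by
        have : ((∑ z ∈ S, halves z : ℕ) : ℝ) ≤ 3 := by exact_mod_cast Nat.lt_succ_iff.mp hlt
        linarith

theorem eq_of_notMem (h : IsLargeSubeigenvector G x lam w)
    (hu : u ∉ insert w (G.neighborSet w)) (hv : v ∉ insert w (G.neighborSet w)) : u = v := by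
  classical
  by_contra hne
  have hsum := h.sum_defect_lt_two {u, v}
  rw [sum_pair hne, defect_of_notMem hu, defect_of_notMem hv] at hsum
  norm_num at hsum

theorem sum_neighborSet_le (h : IsLargeSubeigenvector G x lam w) {p : V} {T S : Finset V}
    (hp : ∀ z, G.Adj p z → z ∈ T ∨ z ∈ S) :
    ∑ z, (G.neighborSet p).indicator x z ≤ #T + ∑ z ∈ S, x z := by
  classical
  have hterm : ∀ z, (G.neighborSet p).indicator x z ≤
      (if z ∈ T then 1 else 0) + if z ∈ S then x z else 0 := fun z => by
    have hx0 := h.nonneg z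
    refine Set.indicator_apply_le' (fun hz => ?_) fun _ => by positivity
    rcases hp z hz with hzT | hzS
    · rw [if_pos hzT]
      split_ifs <;> linarith [h.le_one z]
    · rw [if_pos hzS]
      split_ifs <;> linarith
  calc ∑ z, (G.neighborSet p).indicator x z
      ≤ ∑ z, ((if z ∈ T then 1 else 0) + if z ∈ S then x z else 0) :=
        sum_le_sum fun z _ => hterm z
    _ = #T + ∑ z ∈ S, x z := by
        simp only [sum_add_distrib, sum_ite_mem, univ_inter, sum_const, nsmul_one]

theorem mul_le_card_add_sum (h : IsLargeSubeigenvector G x lam w) {p : V} {T S : Finset V}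
    (hp : p ∈ T) (hS : ∀ z ∉ T, G.Adj p z → z ∈ S) :
    lam * x p ≤ #T - 1 + ∑ z ∈ S, x z := by
  classical
  rw [← cast_card_erase_of_mem hp]
  exact (h.le_sum p).trans <| h.sum_neighborSet_le fun z hz =>
    (em (z ∈ T)).imp (fun hzT => mem_erase.mpr ⟨hz.ne', hzT⟩) fun hzT => hS z hzT hz

theorem exists_adj_mem (h : IsLargeSubeigenvector G x lam w) {T : Finset V} (hb : b ∈ T)
    (hxb : 1 / 2 < x b) (hT : 2 * (#T : ℝ) ≤ lam) :
    ∃ z ∉ T, G.Adj b z ∧ z ∈ insert w (G.neighborSet w) := by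
  classical
  by_contra! hnone
  have hrow := h.mul_le_card_add_sum (S := {z | G.Adj b z ∧ z ∉ insert w (G.neighborSet w)}) hb
    fun z hz hbz => mem_filter.mpr ⟨mem_univ z, hbz, hnone z hz hbz⟩
  have hfar := h.sum_notMem_le_one (S := {z | G.Adj b z ∧ z ∉ insert w (G.neighborSet w)})
    fun z hz => (mem_filter.mp hz).2.2
  have hpos : (0 : ℝ) < #T := by exact_mod_cast card_pos.mpr ⟨b, hb⟩
  nlinarith

theorem exists_adj_isHeavy (h : IsLargeSubeigenvector G x lam w) {T : Finset V} (hb : b ∈ T)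
    (hxb : 1 / 2 < x b) (hT : 2 * (#T : ℝ) + 1 ≤ lam) : ∃ z ∉ T, G.Adj b z ∧ IsHeavy G x w z := by
  classical
  by_contra! hnone
  have hrow := h.mul_le_card_add_sum (S := {z | ¬ IsHeavy G x w z}) hb
    fun z hz hbz => mem_filter.mpr ⟨mem_univ z, hnone z hz hbz⟩
  have hlight := h.sum_light_le (S := {z | ¬ IsHeavy G x w z}) fun z hz => (mem_filter.mp hz).2
  nlinarith [(#T).cast_nonneg (α := ℝ)]

theorem exists_adj_mem_and_half_lt (h : IsLargeSubeigenvector G x lam w) (k : ℕ) {T : Finset V}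
    (hb : b ∈ T) (hxb : 1 / 2 < x b) (hT : 2 * (#T : ℝ) + k ≤ lam) :
    ∃ z ∉ T, G.Adj b z ∧ z ∈ insert w (G.neighborSet w) ∧ (k ≠ 0 → 1 / 2 < x z) := by
  rcases Nat.eq_zero_or_pos k with rfl | hk
  · obtain ⟨z, hzT, hbz, hzmem⟩ := h.exists_adj_mem hb hxb (by simpa using hT)
    exact ⟨z, hzT, hbz, hzmem, fun h0 => absurd rfl h0⟩
  · have hk1 : (1 : ℝ) ≤ k := by exact_mod_cast hk
    obtain ⟨z, hzT, hbz, hz⟩ := h.exists_adj_isHeavy hb hxb (by linarith)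
    exact ⟨z, hzT, hbz, hz.1, fun _ => hz.2⟩

theorem exists_path_to_neighbor (h : IsLargeSubeigenvector G x lam w) (k : ℕ) {F : Finset V}
    (hw : w ∉ F) (hb : b ∉ F) (hwb : G.Adj w b) (hxb : k ≠ 0 → 1 / 2 < x b)
    (hlam : 2 * (#F : ℝ) + 2 * k + 2 ≤ lam) :
    ∃ p : G.Walk w b, p.IsPath ∧ p.length = k + 1 ∧
      ∀ z ∈ p.support, z ∈ insert w (G.neighborSet w) ∧ z ∉ F := by
  classical
  induction k generalizing F b with
  | zero =>
    refine ⟨hwb.toWalk, by simp [hwb.ne], rfl, fun z hz => ?_⟩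
    obtain rfl | rfl : z = w ∨ z = b := by simpa using hz
    · exact ⟨Or.inl rfl, hw⟩
    · exact ⟨Or.inr hwb, hb⟩
  | succ k ih =>
    have hcard : (#(insert w (insert b F)) : ℝ) ≤ #F + 2 := by
      exact_mod_cast (card_insert_le _ _).trans (Nat.succ_le_succ (card_insert_le _ _))
    push_cast at hlam
    obtain ⟨z, hzT, hbz, hzmem, hxz⟩ := h.exists_adj_mem_and_half_lt k
      (T := insert w (insert b F)) (by simp) (hxb k.succ_ne_zero)
      (by linarith [k.cast_nonneg (α := ℝ)])
    simp only [mem_insert, not_or] at hzT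
    obtain ⟨p, hp, hlen, hsupp⟩ := ih (F := insert b F) (by simp [hwb.ne, hw])
      (by simp [hzT]) (hzmem.resolve_left hzT.1) hxz (by
        rw [card_insert_of_notMem hb]
        push_cast
        linarith)
    refine ⟨p.concat hbz.symm, hp.concat (fun hmem => (hsupp b hmem).2 (by simp)) _,
      by simp [hlen], fun y hy => ?_⟩
    rw [SimpleGraph.Walk.support_concat, List.mem_append,
      List.mem_singleton] at hy
    rcases hy with hy | rfl
    · exact ⟨(hsupp y hy).1, fun hyF => (hsupp y hy).2 (mem_insert_of_mem hyF)⟩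
    · exact ⟨Or.inr hwb, hb⟩

theorem exists_path_of_isHeavy_of_notMem (h : IsLargeSubeigenvector G x lam w) (k : ℕ)
    (hv : v ∉ insert w (G.neighborSet w)) (hb : IsHeavy G x w b) (hbv : G.Adj b v)
    (hlam : 2 * (k : ℝ) + 2 ≤ lam) : ∃ p : G.Walk w v, p.IsPath ∧ p.length = k + 2 := by
  have hbw : b ≠ w := fun hbw => hv (Or.inr (hbw ▸ hbv))
  obtain ⟨p, hp, hlen, hsupp⟩ := h.exists_path_to_neighbor k (notMem_empty w) (notMem_empty b)
    (hb.1.resolve_left hbw) (fun _ => hb.2) (by simpa using hlam)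
  exact ⟨p.concat hbv, hp.concat (fun hmem => hv (hsupp v hmem).1) hbv, by simp [hlen]⟩

theorem exists_path_of_isHeavy_of_adj (h : IsLargeSubeigenvector G x lam w) (k : ℕ)
    (huv : u ≠ v) (hnadj : ¬ G.Adj u v) (hwu : G.Adj w u) (hvw : v ≠ w) (hb : IsHeavy G x w b)
    (hbw : b ≠ w) (hbv : G.Adj b v) (hlam : 2 * (k : ℝ) + 6 ≤ lam) :
    ∃ p : G.Walk u v, p.IsPath ∧ p.length = k + 3 := by
  classical
  have hbF : b ∉ ({u, v} : Finset V) := by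
    rw [mem_insert, mem_singleton, not_or]
    exact ⟨fun hbu => hnadj (hbu ▸ hbv), hbv.ne⟩
  obtain ⟨p, hp, hlen, hsupp⟩ := h.exists_path_to_neighbor k (F := {u, v})
    (by simp [hwu.ne, hvw.symm]) hbF (hb.1.resolve_left hbw) (fun _ => hb.2)
    (by rw [card_pair huv]; push_cast; linarith)
  have hu : u ∉ p.support := fun hmem => (hsupp u hmem).2 (by simp)
  have hv : v ∉ p.support := fun hmem => (hsupp v hmem).2 (by simp)
  refine ⟨.cons hwu.symm (p.concat hbv), ?_, by simp [hlen]⟩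
  rw [SimpleGraph.Walk.cons_isPath_iff]
  refine ⟨hp.concat hv hbv, ?_⟩
  simp [SimpleGraph.Walk.support_concat, hu, huv]

theorem exists_isHeavy_adj_of_notMem (h : IsLargeSubeigenvector G x lam w)
    (huv : IsNegativePair G x lam u v) (hv : v ∉ insert w (G.neighborSet w)) (hlam : 0 ≤ lam) :
    ∃ b, IsHeavy G x w b ∧ G.Adj b v := by
  classical
  by_contra! hnone
  have hterm : ∀ z, (G.neighborSet v).indicator x z ≤
      if z ∈ ({u, v} : Finset V)ᶜ then defect G x w z else 0 := fun z => by
    refine Set.indicator_apply_le' (fun hz => ?_) fun _ => ?_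
    · rw [if_pos]
      · exact h.le_defect_of_not_isHeavy fun hheavy => hnone z hheavy hz.symm
      · rw [mem_compl, mem_insert, mem_singleton, not_or]
        exact ⟨fun hzu => huv.not_adj (hzu ▸ hz).symm, (G.ne_of_adj hz).symm⟩
    · split_ifs
      exacts [h.defect_nonneg z, le_rfl]
  have hrow := huv.le_right.trans (sum_le_sum fun z _ => hterm z)
  rw [sum_ite_mem, univ_inter] at hrow
  have htotal := h.sum_defect_lt_two univ
  rw [← sum_compl_add_sum {u, v}, sum_pair huv.ne, defect_of_notMem hv] at htotal
  nlinarith [h.one_sub_le_defect u, h.nonneg v]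

theorem exists_path_of_notMem (h : IsLargeSubeigenvector G x lam w)
    (huv : IsNegativePair G x lam u v) (hv : v ∉ insert w (G.neighborSet w)) {m : ℕ} (hm : 3 ≤ m)
    (hlam : 2 * (m : ℝ) ≤ lam) : ∃ p : G.Walk u v, p.IsPath ∧ p.length = m := by
  obtain ⟨k, rfl⟩ := Nat.exists_eq_add_of_le' hm
  push_cast at hlam
  have : (0 : ℝ) ≤ k := k.cast_nonneg
  obtain ⟨b, hb, hbv⟩ := h.exists_isHeavy_adj_of_notMem huv hv (by linarith)
  have hu : u ∈ insert w (G.neighborSet w) := by_contra fun hu => huv.ne (h.eq_of_notMem hu hv)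
  have hvw : v ≠ w := fun hvw => hv (Or.inl hvw)
  rcases hu with rfl | hwu
  · exact h.exists_path_of_isHeavy_of_notMem (k + 1) hv hb hbv (by push_cast; linarith)
  · have hbw : b ≠ w := fun hbw => hv (Or.inr (hbw ▸ hbv))
    exact h.exists_path_of_isHeavy_of_adj k huv.ne huv.not_adj hwu hvw hb hbw hbv (by linarith)

theorem adj_iff_eq_of_not_isHeavy (h : IsLargeSubeigenvector G x lam w)
    (huv : IsNegativePair G x lam u v) (hwu : G.Adj w u) (hwv : G.Adj w v)
    (hlight : ∀ b ≠ w, G.Adj u b ∨ G.Adj v b → ¬ IsHeavy G x w b) (hlam : 5 ≤ lam) (z : V) :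
    (G.Adj u z ↔ z = w) ∧ (G.Adj v z ↔ z = w) := by
  classical
  set K : Finset V := {z | z ≠ w ∧ (G.Adj u z ∨ G.Adj v z)} with K_def
  have hxK : ∑ z ∈ K, x z ≤ ∑ z ∈ K, defect G x w z := sum_le_sum fun z hz =>
    have hz := (mem_filter.mp hz).2
    h.le_defect_of_not_isHeavy (hlight z hz.1 hz.2)
  have hdefect : ∑ z ∈ K, defect G x w z < x u + x v := by
    have hK : Disjoint {u, v} K := by
      simp [K_def, huv.not_adj, huv.symm.not_adj]
    have htotal := h.sum_defect_lt_two ({u, v} ∪ K)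
    rw [sum_union hK, sum_pair huv.ne, defect_of_mem (Or.inr hwu), defect_of_mem (Or.inr hwv)]
      at htotal
    linarith
  have hrow : ∀ p, (∀ z, G.Adj p z → z = w ∨ z ∈ K) →
      ∑ z, (G.neighborSet p).indicator x z ≤ 1 + ∑ z ∈ K, x z := fun p hp => by
    simpa using h.sum_neighborSet_le (T := {w}) fun z hz => by simpa using hp z hz
  have hK : K = ∅ := by
    by_contra hne
    obtain ⟨y, hy⟩ := nonempty_iff_ne_empty.mpr hne
    have hy' := (mem_filter.mp hy).2
    have hhalf := (h.half_le_defect_of_not_isHeavy (hlight y hy'.1 hy'.2)).trans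
      (single_le_sum (fun z _ => h.defect_nonneg z) hy)
    have hu := huv.le_left.trans (hrow u fun z hz => by simp [K_def, hz, em])
    have hv := huv.le_right.trans (hrow v fun z hz => by simp [K_def, hz, em])
    nlinarith
  have honly : ∀ z, G.Adj u z ∨ G.Adj v z → z = w := fun z hz => by
    by_contra hzw
    have : z ∈ K := mem_filter.mpr ⟨mem_univ z, hzw, hz⟩
    simp [hK] at this
  exact ⟨⟨fun hz => honly z (Or.inl hz), fun hz => hz ▸ hwu.symm⟩,
    ⟨fun hz => honly z (Or.inr hz), fun hz => hz ▸ hwv.symm⟩⟩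

theorem exists_path_or_adj_iff_eq (h : IsLargeSubeigenvector G x lam w)
    (huv : IsNegativePair G x lam u v) {m : ℕ} (hm : 3 ≤ m) (hlam : 2 * (m : ℝ) ≤ lam) :
    (∃ p : G.Walk u v, p.IsPath ∧ p.length = m) ∨
      ∀ z, (G.Adj u z ↔ z = w) ∧ (G.Adj v z ↔ z = w) := by
  have reverse : (∃ p : G.Walk v u, p.IsPath ∧ p.length = m) →
      ∃ p : G.Walk u v, p.IsPath ∧ p.length = m := fun ⟨p, hp, hlen⟩ =>
    ⟨p.reverse, hp.reverse, by rw [SimpleGraph.Walk.length_reverse, hlen]⟩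
  by_cases hv : v ∈ insert w (G.neighborSet w)
  swap
  · exact Or.inl (h.exists_path_of_notMem huv hv hm hlam)
  by_cases hu : u ∈ insert w (G.neighborSet w)
  swap
  · exact Or.inl (reverse (h.exists_path_of_notMem huv.symm hu hm hlam))
  have huw : u ≠ w := by
    rintro rfl
    exact huv.not_adj (hv.resolve_left huv.ne.symm)
  have hvw : v ≠ w := by
    rintro rfl
    exact huv.not_adj (hu.resolve_left huv.ne).symm
  have hwu := hu.resolve_left huw
  have hwv := hv.resolve_left hvw
  obtain ⟨k, rfl⟩ := Nat.exists_eq_add_of_le' hm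
  push_cast at hlam
  have : (0 : ℝ) ≤ k := k.cast_nonneg
  by_cases hlight : ∀ b ≠ w, G.Adj u b ∨ G.Adj v b → ¬ IsHeavy G x w b
  · exact Or.inr (h.adj_iff_eq_of_not_isHeavy huv hwu hwv hlight (by linarith))
  push Not at hlight
  obtain ⟨b, hbw, hub | hvb, hb⟩ := hlight
  · exact Or.inl <| reverse <| h.exists_path_of_isHeavy_of_adj k huv.ne.symm huv.symm.not_adj hwv
      huw hb hbw hub.symm (by linarith)
  · exact Or.inl <| h.exists_path_of_isHeavy_of_adj k huv.ne huv.not_adj hwu hvw hb hbw hvb.symm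
      (by linarith)

end IsLargeSubeigenvector

namespace SignedGraph

section Basic

variable {V W : Type*} (Γ : SignedGraph V)

theorem adjMatrix_of_adj {i j : V} (h : Γ.graph.Adj i j) :
    Γ.adjMatrix i j = ((Γ.sign ⟨s(i, j), h⟩ : ℤ) : ℝ) :=
  dif_pos h

theorem adjMatrix_of_not_adj {i j : V} (h : ¬ Γ.graph.Adj i j) : Γ.adjMatrix i j = 0 :=
  dif_neg h

theorem adjMatrix_comm (i j : V) : Γ.adjMatrix i j = Γ.adjMatrix j i := by
  simpa using Γ.adjMatrix_isHermitian.apply j i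

theorem adjMatrix_ne_zero_iff {i j : V} : Γ.adjMatrix i j ≠ 0 ↔ Γ.graph.Adj i j := by
  refine ⟨not_imp_comm.mp Γ.adjMatrix_of_not_adj, fun h => ?_⟩
  rw [Γ.adjMatrix_of_adj h]
  exact_mod_cast (Γ.sign ⟨s(i, j), h⟩).ne_zero

theorem adjMatrix_eq_one_iff {i j : V} (h : Γ.graph.Adj i j) :
    Γ.adjMatrix i j = 1 ↔ Γ.sign ⟨s(i, j), h⟩ = 1 := by
  rw [Γ.adjMatrix_of_adj h, Units.ext_iff, Units.val_one]
  norm_cast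

theorem adjMatrix_eq_neg_one_iff {i j : V} (h : Γ.graph.Adj i j) :
    Γ.adjMatrix i j = -1 ↔ Γ.sign ⟨s(i, j), h⟩ = -1 := by
  rw [Γ.adjMatrix_of_adj h, Units.ext_iff, Units.val_neg, Units.val_one]
  norm_cast

theorem adjMatrix_le_one (i j : V) : Γ.adjMatrix i j ≤ 1 := by
  by_cases h : Γ.graph.Adj i j
  · rw [Γ.adjMatrix_of_adj h]
    rcases Int.units_eq_one_or (Γ.sign ⟨s(i, j), h⟩) with hs | hs <;> norm_num [hs]
  · exact (Γ.adjMatrix_of_not_adj h).trans_le zero_le_one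

theorem switchingEquivalent_of_adjMatrix {Γ : SignedGraph V} {Γ' : SignedGraph W} (e : V ≃ W)
    (h : ∀ i j, Γ'.adjMatrix (e i) (e j) = Γ.adjMatrix i j) : Γ.SwitchingEquivalent Γ' := by
  refine ⟨⟨e, fun {i j} => ?_⟩, 1, fun i j hij => ?_⟩
  · rw [← adjMatrix_ne_zero_iff, ← adjMatrix_ne_zero_iff, h]
  · have hij' : Γ'.graph.Adj (e i) (e j) := by
      rwa [← adjMatrix_ne_zero_iff, h, adjMatrix_ne_zero_iff]
    have hsign := h i j
    rw [Γ'.adjMatrix_of_adj hij', Γ.adjMatrix_of_adj hij, Int.cast_inj, Units.val_inj] at hsign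
    simpa using hsign

theorem walkSign_nil {a : V} : Γ.walkSign (.nil : Γ.graph.Walk a a) = 1 :=
  rfl

theorem walkSign_cons {a b c : V} (h : Γ.graph.Adj a b) (p : Γ.graph.Walk b c) :
    Γ.walkSign (.cons h p) = Γ.sign ⟨s(a, b), h⟩ * Γ.walkSign p := by
  simp [walkSign, SimpleGraph.Dart.edge]

theorem walkSign_eq_one {a b : V} (p : Γ.graph.Walk a b)
    (hp : ∀ i j, (h : s(i, j) ∈ p.edges) → Γ.sign ⟨s(i, j), p.edges_subset_edgeSet h⟩ = 1) :
    Γ.walkSign p = 1 := by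
  induction p with
  | nil => rfl
  | cons h p ih =>
    rw [walkSign_cons, hp _ _ (by simp), one_mul]
    exact ih fun i j hij => hp i j (by simp [hij])

end Basic

section Switching

variable {V W : Type*} (Γ : SignedGraph V) (θ : V → ℤˣ)

/-- The signed graph obtained from `Γ` by reversing the signs of the edges between
`{u | θ u = 1}` and `{u | θ u = -1}`. -/
def switch : SignedGraph V where
  graph := Γ.graph
  sign e := Sym2.lift ⟨fun u v => θ u * θ v, fun _ _ => mul_comm _ _⟩ e * Γ.sign e

theorem adjMatrix_switch (i j : V) :
    (Γ.switch θ).adjMatrix i j = ((θ i : ℤ) : ℝ) * Γ.adjMatrix i j * ((θ j : ℤ) : ℝ) := by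
  by_cases h : Γ.graph.Adj i j
  · rw [Γ.adjMatrix_of_adj h, (Γ.switch θ).adjMatrix_of_adj h]
    simp only [switch, Sym2.lift_mk, Units.val_mul, Int.cast_mul]
    ring
  · rw [Γ.adjMatrix_of_not_adj h, (Γ.switch θ).adjMatrix_of_not_adj h, mul_zero, zero_mul]

theorem walkSign_switch {a b : V} (p : Γ.graph.Walk a b) :
    (Γ.switch θ).walkSign p = θ a * Γ.walkSign p * θ b := by
  induction p with
  | @nil a => exact (Int.units_mul_self (θ a)).symm.trans (by rw [walkSign_nil, mul_one])
  | @cons a b c h p ih =>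
    calc (Γ.switch θ).walkSign (.cons h p)
        = θ a * θ b * Γ.sign ⟨s(a, b), h⟩ * (Γ.switch θ).walkSign p :=
          (Γ.switch θ).walkSign_cons h p
      _ = θ a * (Γ.sign ⟨s(a, b), h⟩ * Γ.walkSign p) * θ c * (θ b * θ b) := by
          rw [ih]
          ac_rfl
      _ = θ a * Γ.walkSign (.cons h p) * θ c := by
          rw [Int.units_mul_self, mul_one, walkSign_cons]

theorem isBalanced_of_switch (h : (Γ.switch θ).IsBalanced) : Γ.IsBalanced := fun v p hp => by
  have hsign := h v p hp
  rwa [walkSign_switch, mul_right_comm, Int.units_mul_self, one_mul] at hsign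

theorem hasNegativeCycle_of_switch {r : ℕ} (h : (Γ.switch θ).HasNegativeCycle r) :
    Γ.HasNegativeCycle r := by
  obtain ⟨v, p, hp, hlen, hsign⟩ := h
  refine ⟨v, p, hp, hlen, ?_⟩
  rwa [Γ.walkSign_switch θ p, mul_right_comm, Int.units_mul_self, one_mul] at hsign

theorem switchingEquivalent_of_switch {Γ' : SignedGraph W}
    (h : (Γ.switch θ).SwitchingEquivalent Γ') : Γ.SwitchingEquivalent Γ' := by
  obtain ⟨e, η, h⟩ := h
  refine ⟨e, η * θ, fun u v huv => (h u v huv).trans ?_⟩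
  simp only [switch, Sym2.lift_mk, Pi.mul_apply]
  ac_rfl

open Matrix

theorem exists_switch_mulVec_abs [Fintype V] {μ : ℝ} {y : V → ℝ}
    (hy : Γ.adjMatrix *ᵥ y = μ • y) :
    ∃ θ : V → ℤˣ, (Γ.switch θ).adjMatrix *ᵥ |y| = μ • |y| := by
  set θ : V → ℤˣ := fun i => if 0 ≤ y i then 1 else -1 with θ_def
  have habs : ∀ i, ((θ i : ℤ) : ℝ) * y i = |y i| := fun i => by
    by_cases hi : 0 ≤ y i
    · simp [θ_def, hi, abs_of_nonneg]
    · simp [θ_def, hi, abs_of_neg (not_le.mp hi)]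
  have hself : ∀ i, ((θ i : ℤ) : ℝ) * |y i| = y i := fun i => by
    rw [← habs, ← mul_assoc, ← Int.cast_mul, Int.units_coe_mul_self, Int.cast_one, one_mul]
  refine ⟨θ, funext fun i => ?_⟩
  calc ((Γ.switch θ).adjMatrix *ᵥ |y|) i
      = ((θ i : ℤ) : ℝ) * (Γ.adjMatrix *ᵥ y) i := by
        simp only [mulVec, dotProduct, adjMatrix_switch, Pi.abs_apply, mul_assoc, hself,
          Finset.mul_sum]
    _ = μ * |y i| := by
        rw [hy, Pi.smul_apply, smul_eq_mul, mul_left_comm, habs]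

theorem exists_switch_eigenvector [Fintype V] [DecidableEq V] [Nonempty V] :
    ∃ (θ : V → ℤˣ) (x : V → ℝ) (w : V), 0 ≤ x ∧ x ≤ 1 ∧ x w = 1 ∧
      (Γ.switch θ).adjMatrix *ᵥ x = Γ.index • x := by
  obtain ⟨y, hy, heig⟩ := exists_mulVec_eq_smul Γ.index_isGreatest.1
  obtain ⟨w, hw⟩ := Finite.exists_max |y|
  have hpos : 0 < |y| w := by
    obtain ⟨i, hi⟩ := Function.ne_iff.mp hy
    exact (abs_pos.mpr hi).trans_le (hw i)
  obtain ⟨θ, hθ⟩ := Γ.exists_switch_mulVec_abs heig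
  refine ⟨θ, (|y| w)⁻¹ • |y|, w, smul_nonneg (by positivity) (abs_nonneg y), fun i => ?_, ?_, ?_⟩
  · exact inv_mul_le_one_of_le₀ (hw i) hpos.le
  · exact inv_mul_cancel₀ hpos.ne'
  · rw [mulVec_smul, hθ, smul_comm]

end Switching

section PositivePart

variable {V : Type*} (Γ : SignedGraph V)

/-- The graph formed by the positive edges of a signed graph. -/
def positivePart : SimpleGraph V where
  Adj i j := ∃ h : Γ.graph.Adj i j, Γ.sign ⟨s(i, j), h⟩ = 1
  symm := ⟨fun i j ⟨h, hs⟩ => ⟨h.symm, by simpa only [Sym2.eq_swap] using hs⟩⟩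
  loopless := ⟨fun i ⟨h, _⟩ => Γ.graph.irrefl h⟩

theorem positivePart_le : Γ.positivePart ≤ Γ.graph := fun _ _ h => h.1

theorem positivePart_adj_iff {i j : V} : Γ.positivePart.Adj i j ↔ Γ.adjMatrix i j = 1 := by
  refine ⟨fun ⟨h, hs⟩ => (Γ.adjMatrix_eq_one_iff h).mpr hs, fun h => ?_⟩
  have hadj : Γ.graph.Adj i j := Γ.adjMatrix_ne_zero_iff.mp (h.trans_ne one_ne_zero)
  exact ⟨hadj, (Γ.adjMatrix_eq_one_iff hadj).mp h⟩

theorem adjMatrix_nonpos_of_not_positivePart_adj {i j : V} (h : ¬ Γ.positivePart.Adj i j) :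
    Γ.adjMatrix i j ≤ 0 := by
  by_cases hadj : Γ.graph.Adj i j
  · have hsign := (Int.units_eq_one_or _).resolve_left fun hs => h ⟨hadj, hs⟩
    rw [(Γ.adjMatrix_eq_neg_one_iff hadj).mpr hsign]
    norm_num
  · exact (Γ.adjMatrix_of_not_adj hadj).le

theorem adjMatrix_mul_le_indicator {x : V → ℝ} (hx : 0 ≤ x) (i j : V) :
    Γ.adjMatrix i j * x j ≤ (Γ.positivePart.neighborSet i).indicator x j := by
  refine Set.le_indicator_apply (fun h => ?_) fun h => ?_
  · rw [Γ.positivePart_adj_iff.mp h, one_mul]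
  · exact mul_nonpos_of_nonpos_of_nonneg (Γ.adjMatrix_nonpos_of_not_positivePart_adj h) (hx j)

theorem exists_negative_edge (h : ¬ Γ.IsBalanced) : ∃ u v, Γ.adjMatrix u v = -1 := by
  contrapose! h
  refine fun v p _ => Γ.walkSign_eq_one p fun i j hij => ?_
  exact (Int.units_eq_one_or _).resolve_right fun hs => h i j <|
    (Γ.adjMatrix_eq_neg_one_iff (p.edges_subset_edgeSet hij)).mpr hs

theorem hasNegativeCycle_of_path {u v : V} (huv : Γ.adjMatrix u v = -1)
    {p : Γ.positivePart.Walk u v} (hp : p.IsPath) : Γ.HasNegativeCycle (p.length + 1) := by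
  have hadj : Γ.graph.Adj u v := Γ.adjMatrix_ne_zero_iff.mp (huv.trans_ne (by norm_num))
  have hsign : Γ.sign ⟨s(v, u), hadj.symm⟩ = -1 := by
    rwa [← adjMatrix_eq_neg_one_iff, adjMatrix_comm]
  have hedge {i j : V} (hij : s(i, j) ∈ (p.mapLe Γ.positivePart_le).edges) :
      Γ.positivePart.Adj i j := by
    rw [SimpleGraph.Walk.edges_mapLe_eq_edges] at hij
    exact p.adj_of_mem_edges hij
  refine ⟨v, .cons hadj.symm (p.mapLe Γ.positivePart_le), ?_, ?_, ?_⟩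
  · refine SimpleGraph.Walk.cons_isCycle_iff _ _ |>.mpr ⟨hp.mapLe _, fun hmem => ?_⟩
    obtain ⟨_, hpos⟩ := hedge hmem
    rw [hsign] at hpos
    exact absurd hpos (by decide)
  · rw [SimpleGraph.Walk.length_cons, SimpleGraph.Walk.length_map]
  · rw [walkSign_cons, hsign, Γ.walkSign_eq_one _ fun i j hij => (hedge hij).2, mul_one]

open Matrix

variable [Fintype V] {x : V → ℝ} {lam : ℝ}

theorem mul_le_sum_positivePart (hx : 0 ≤ x) (heig : Γ.adjMatrix *ᵥ x = lam • x) (i : V) :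
    lam * x i ≤ ∑ j, (Γ.positivePart.neighborSet i).indicator x j :=
  (congrFun heig i).symm.trans_le <|
    Finset.sum_le_sum fun j _ => Γ.adjMatrix_mul_le_indicator hx i j

theorem mul_add_le_sum_positivePart (hx : 0 ≤ x) (heig : Γ.adjMatrix *ᵥ x = lam • x) {i j : V}
    (hij : Γ.adjMatrix i j = -1) :
    lam * x i + x j ≤ ∑ k, (Γ.positivePart.neighborSet i).indicator x k := by
  classical
  have hterm : ∀ k, Γ.adjMatrix i k * x k + (if k = j then x k else 0) ≤
      (Γ.positivePart.neighborSet i).indicator x k := fun k => by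
    split_ifs with hk
    · rw [hk, hij, neg_one_mul, neg_add_cancel]
      exact Set.indicator_nonneg (fun k _ => hx k) j
    · rw [add_zero]
      exact Γ.adjMatrix_mul_le_indicator hx i k
  calc lam * x i + x j = ∑ k, (Γ.adjMatrix i k * x k + if k = j then x k else 0) := by
        rw [Finset.sum_add_distrib, Fintype.sum_ite_eq']
        exact congrArg (· + x j) (congrFun heig i).symm
    _ ≤ ∑ k, (Γ.positivePart.neighborSet i).indicator x k :=
        Finset.sum_le_sum fun k _ => hterm k

theorem isNegativePair (hx : 0 ≤ x) (heig : Γ.adjMatrix *ᵥ x = lam • x) {u v : V}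
    (huv : Γ.adjMatrix u v = -1) : IsNegativePair Γ.positivePart x lam u v where
  ne := (Γ.adjMatrix_ne_zero_iff.mp (huv.trans_ne (by norm_num))).ne
  not_adj h := by
    rw [positivePart_adj_iff, huv] at h
    norm_num at h
  le_left := Γ.mul_add_le_sum_positivePart hx heig huv
  le_right := Γ.mul_add_le_sum_positivePart hx heig ((Γ.adjMatrix_comm v u).trans huv)

end PositivePart

section TriangleClique

open Matrix

variable {n : ℕ} {i j c : Fin n}

theorem triangleClique_adjMatrix_apply (i j : Fin n) :
    (triangleClique n).adjMatrix i j =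
      if i ≠ j ∧ ((i.val ≤ 2 ∧ j.val ≤ 2) ∨ (2 ≤ i.val ∧ 2 ≤ j.val)) then
        if i.val + j.val = 1 then -1 else 1
      else 0 := by
  have hadj : (triangleClique n).graph.Adj i j ↔
    (i ≠ j ∧ ((i.val ≤ 2 ∧ j.val ≤ 2) ∨ (2 ≤ i.val ∧ 2 ≤ j.val))) := Iff.rfl
  have hneg : s(i.val, j.val) = s(0, 1) ↔ i.val + j.val = 1 := by
    rw [Sym2.eq_iff]
    omega
  by_cases h : (triangleClique n).graph.Adj i j
  · rw [adjMatrix_of_adj _ h, if_pos (hadj.mp h)]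
    simp only [triangleClique, Sym2.map_mk, hneg]
    split_ifs <;> simp
  · rw [adjMatrix_of_not_adj _ h, if_neg (mt hadj.mpr h)]

theorem triangleClique_mulVec_of_add_eq_one (hij : i.val + j.val = 1) (hc : c.val = 2)
    (z : Fin n → ℝ) : ((triangleClique n).adjMatrix *ᵥ z) i = z c - z j := by
  have hrow : ∀ k, (triangleClique n).adjMatrix i k * z k =
      (if k = c then z k else 0) - if k = j then z k else 0 := fun k => by
    rw [triangleClique_adjMatrix_apply]
    simp only [Fin.ext_iff, hc]
    split_ifs <;> first | omega | ring
  simp only [mulVec, dotProduct, hrow, Finset.sum_sub_distrib, Fintype.sum_ite_eq']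

theorem triangleClique_mulVec_of_two_le (hi : 2 ≤ i.val) (z : Fin n → ℝ)
    (hz : ∀ k : Fin n, k.val < 2 → z k = 0) :
    ((triangleClique n).adjMatrix *ᵥ z) i = ∑ k, z k - z i := by
  have hrow : ∀ k, (triangleClique n).adjMatrix i k * z k =
      z k - if k = i then z k else 0 := fun k => by
    rw [triangleClique_adjMatrix_apply]
    simp only [Fin.ext_iff]
    rcases lt_or_ge k.val 2 with hk | hk
    · simp [hz k hk]
    · split_ifs <;> first | omega | ring
  simp only [mulVec, dotProduct, hrow, Finset.sum_sub_distrib, Fintype.sum_ite_eq']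

theorem lt_index_triangleClique (hn : 3 ≤ n) : (n : ℝ) - 3 < (triangleClique n).index := by
  have : Nonempty (Fin n) := ⟨⟨0, by omega⟩⟩
  set y : Fin n → ℝ := fun k => if 2 ≤ k.val then 1 else 0 with y_def
  have hlow : ∀ k : Fin n, k.val < 2 → y k = 0 := fun k hk => if_neg hk.not_ge
  have hsum : ∑ k, y k = n - 2 := by
    have hfilter : ({k | 2 ≤ k.val} : Finset (Fin n)) = Finset.Ici ⟨2, by omega⟩ := by
      ext k
      simp [Fin.le_def]
    rw [Finset.sum_boole, hfilter, Fin.card_Ici, Nat.cast_sub (by omega), Nat.cast_two]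
  refine lt_of_le_dotProduct_of_mulVec_ne (triangleClique n).adjMatrix_isHermitian
    (triangleClique n).index_isGreatest.2 (y := y) ?_ fun h => ?_
  · rw [dotProduct, Finset.mul_sum, dotProduct]
    refine (Finset.sum_congr rfl fun k _ => ?_).le
    rcases lt_or_ge k.val 2 with hk | hk
    · simp [hlow k hk]
    · rw [triangleClique_mulVec_of_two_le hk y hlow, hsum, show y k = 1 from if_pos hk]
      ring
  · have h0 := congrFun h ⟨0, by omega⟩
    rw [triangleClique_mulVec_of_add_eq_one (j := ⟨1, by omega⟩) (c := ⟨2, by omega⟩) rfl rfl] at h0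
    simp [y_def] at h0

theorem pos_of_triangleClique_mulVec_eq {z : Fin n → ℝ} {t : ℝ} (hc : c.val = 2) (hz : 0 ≤ z)
    (hzc : 0 < z c) (ht : 1 < t) (heig : (triangleClique n).adjMatrix *ᵥ z = t • z) (i : Fin n) :
    0 < z i := by
  have hrow : ∀ k, ((triangleClique n).adjMatrix *ᵥ z) k = t * z k := congrFun heig
  have hlow {i j : Fin n} (hij : i.val + j.val = 1) : 0 < z i := by
    have hi := hrow i
    have hj := hrow j
    rw [triangleClique_mulVec_of_add_eq_one hij hc] at hi
    rw [triangleClique_mulVec_of_add_eq_one ((add_comm _ _).trans hij) hc] at hj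
    have hzij : z i = z j := by
      have : (t - 1) * (z i - z j) = 0 := by linarith
      exact sub_eq_zero.mp ((mul_eq_zero.mp this).resolve_left (sub_pos.mpr ht).ne')
    nlinarith
  rcases lt_trichotomy i.val 2 with hi | hi | hi
  · exact hlow (j := ⟨1 - i.val, by omega⟩) (by change i.val + (1 - i.val) = 1; omega)
  · rwa [show i = c from Fin.ext (hi.trans hc.symm)]
  · have hnonneg : ∀ k ∈ Finset.univ, 0 ≤ (triangleClique n).adjMatrix i k * z k := fun k _ => by
      refine mul_nonneg ?_ (hz k)
      rw [triangleClique_adjMatrix_apply]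
      split_ifs <;> first | omega | norm_num
    have hentry : (triangleClique n).adjMatrix i c = 1 := by
      rw [triangleClique_adjMatrix_apply, if_pos ⟨Fin.ne_of_gt (hc.trans_lt hi), by omega⟩,
        if_neg (by omega)]
    have hsum := (Finset.single_le_sum hnonneg (Finset.mem_univ c)).trans_eq (hrow i)
    rw [hentry, one_mul] at hsum
    exact pos_of_mul_pos_right (hzc.trans_le hsum) (by linarith)

theorem eq_triangleClique_adjMatrix {B : Matrix (Fin n) (Fin n) ℝ} {z : Fin n → ℝ} {t : ℝ}
    (hn : 4 ≤ n) (hB : ∀ i j, B i j ≤ (triangleClique n).adjMatrix i j) (hz : 0 ≤ z)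
    (hc : c.val = 2) (hzc : 0 < z c) (heig : B *ᵥ z = t • z)
    (ht : (triangleClique n).index ≤ t) : B = (triangleClique n).adjMatrix := by
  have : Nonempty (Fin n) := ⟨c⟩
  have hA := mulVec_eq_smul_of_dominated (triangleClique n).adjMatrix_isHermitian
    (triangleClique n).index_isGreatest.2 hB hz heig ht
  have ht1 : 1 < t := by
    have hn' : (4 : ℝ) ≤ n := by exact_mod_cast hn
    linarith [lt_index_triangleClique (n := n) (by omega)]
  exact eq_of_le_of_mulVec_eq hB (pos_of_triangleClique_mulVec_eq hc hz hzc ht1 hA)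
    (heig.trans hA.symm)

variable {V : Type*}

theorem exists_equiv_fin [Fintype V] {k : ℕ} (hV : Fintype.card V = n) {f : Fin k → V}
    (hf : Function.Injective f) : ∃ e : V ≃ Fin n, ∀ i, (e (f i)).val = i.val := by
  have hkn : k ≤ n := by simpa [hV] using Fintype.card_le_of_injective f hf
  let e := Fintype.equivFinOfCardEq hV
  obtain ⟨σ, hσ⟩ := Equiv.Perm.exists_extending_pair (e ∘ f) (Fin.castLE hkn)
    (e.injective.comp hf) (Fin.castLE_injective hkn)
  exact ⟨e.trans σ, fun i => congrArg Fin.val (hσ i)⟩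

theorem adjMatrix_le_triangleClique (Γ : SignedGraph V) {u v w : V} (e : V ≃ Fin n)
    (heu : (e u).val = 0) (hev : (e v).val = 1) (hew : (e w).val = 2)
    (huv : Γ.adjMatrix u v = -1) (hu : ∀ z, Γ.positivePart.Adj u z → z = w)
    (hv : ∀ z, Γ.positivePart.Adj v z → z = w) (i j : V) :
    Γ.adjMatrix i j ≤ (triangleClique n).adjMatrix (e i) (e j) := by
  have heq {a b : V} (hab : (e a).val = (e b).val) : a = b := e.injective (Fin.ext hab)
  rw [triangleClique_adjMatrix_apply]
  split_ifs with hadj hij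
  · obtain ⟨hi, hj⟩ | ⟨hi, hj⟩ :
        (e i).val = 0 ∧ (e j).val = 1 ∨ (e i).val = 1 ∧ (e j).val = 0 := by omega
    · rw [heq (hi.trans heu.symm), heq (hj.trans hev.symm), huv]
    · rw [heq (hi.trans hev.symm), heq (hj.trans heu.symm), adjMatrix_comm, huv]
  · exact Γ.adjMatrix_le_one i j
  · refine Γ.adjMatrix_nonpos_of_not_positivePart_adj fun hpos =>
      hadj ⟨e.injective.ne hpos.ne, ?_⟩
    have hlow {a b : V} (hab : Γ.positivePart.Adj a b) (ha : (e a).val < 2) :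
        (e b).val = 2 := by
      obtain ha | ha : (e a).val = 0 ∨ (e a).val = 1 := by omega
      · rw [hu b (heq (ha.trans heu.symm) ▸ hab), hew]
      · rw [hv b (heq (ha.trans hev.symm) ▸ hab), hew]
    have hi := hlow hpos
    have hj := hlow hpos.symm
    omega

theorem switchingEquivalent_triangleClique [Fintype V] (Γ : SignedGraph V) {x : V → ℝ} {t : ℝ}
    {u v w : V} (hn : Fintype.card V = n) (hn4 : 4 ≤ n) (hx : 0 ≤ x) (hxw : 0 < x w)
    (heig : Γ.adjMatrix *ᵥ x = t • x) (ht : (triangleClique n).index ≤ t)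
    (huv : Γ.adjMatrix u v = -1)
    (hw : ∀ z, (Γ.positivePart.Adj u z ↔ z = w) ∧ (Γ.positivePart.Adj v z ↔ z = w)) :
    Γ.SwitchingEquivalent (triangleClique n) := by
  have hne : u ≠ v := (Γ.isNegativePair hx heig huv).ne
  have huw : u ≠ w := ((hw w).1.mpr rfl).ne
  have hvw : v ≠ w := ((hw w).2.mpr rfl).ne
  obtain ⟨e, he⟩ := exists_equiv_fin hn (f := ![u, v, w]) (by
    simp [← List.nodup_ofFn, hne, huw, hvw])
  have hdom := Γ.adjMatrix_le_triangleClique e (he 0) (he 1) (he 2) huv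
    (fun z => (hw z).1.mp) fun z => (hw z).2.mp
  have hB : Γ.adjMatrix.submatrix e.symm e.symm = (triangleClique n).adjMatrix := by
    refine eq_triangleClique_adjMatrix (z := x ∘ e.symm) (c := e w) (t := t) hn4
      (fun i j => ?_) (fun i => hx _) (he 2) (by simpa using hxw) ?_ ht
    · simpa using hdom (e.symm i) (e.symm j)
    · rw [submatrix_mulVec_equiv, Equiv.symm_symm, Function.comp_assoc, Equiv.symm_comp_self,
        Function.comp_id, heig]
      rfl
  refine switchingEquivalent_of_adjMatrix e fun i j => ?_
  rw [← hB, submatrix_apply, e.symm_apply_apply, e.symm_apply_apply]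

end TriangleClique

end SignedGraph

theorem mainTheorem1_general {V : Type*} [Fintype V] [DecidableEq V] (Γ : SignedGraph V) (n r : ℕ)
    (hn : Fintype.card V = n) (hΓ : ¬ Γ.IsBalanced)
    (hr : 4 ≤ r) (hrn : 2 * r < n)
    (hindex : (SignedGraph.triangleClique n).index ≤ Γ.index) :
    Γ.HasNegativeCycle r ∨ Γ.SwitchingEquivalent (SignedGraph.triangleClique n) := by
  have : Nonempty V := Fintype.card_pos_iff.mp (by omega)
  have hlt : (n : ℝ) - 3 < Γ.index :=
    (SignedGraph.lt_index_triangleClique (by omega)).trans_le hindex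
  obtain ⟨m, rfl⟩ := Nat.exists_eq_add_of_le' (show 1 ≤ r by omega)
  have hm : 2 * (m : ℝ) ≤ Γ.index := by
    have : 2 * (m : ℝ) + 3 ≤ n := by exact_mod_cast (by omega : 2 * m + 3 ≤ n)
    linarith
  obtain ⟨θ, x, w, hx0, hx1, hxw, heig⟩ := Γ.exists_switch_eigenvector
  obtain ⟨u, v, huv⟩ := (Γ.switch θ).exists_negative_edge (mt (Γ.isBalanced_of_switch θ) hΓ)
  have hx : IsLargeSubeigenvector (Γ.switch θ).positivePart x Γ.index w :=
    ⟨hx0, hx1, hxw, hn ▸ hlt, (Γ.switch θ).mul_le_sum_positivePart hx0 heig⟩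
  rcases hx.exists_path_or_adj_iff_eq ((Γ.switch θ).isNegativePair hx0 heig huv)
    (m := m) (by omega) hm with ⟨p, hp, rfl⟩ | hw
  · exact Or.inl (Γ.hasNegativeCycle_of_switch θ ((Γ.switch θ).hasNegativeCycle_of_path huv hp))
  · exact Or.inr <| Γ.switchingEquivalent_of_switch θ <|
      (Γ.switch θ).switchingEquivalent_triangleClique hn (by omega) hx0 (hxw ▸ one_pos) heig
        hindex huv hw

theorem mainTheorem1 {V : Type*} [Fintype V] [DecidableEq V] (Γ : SignedGraph V) (n r : ℕ)
    (hn : Fintype.card V = n) (hΓ : ¬ Γ.IsBalanced)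
    (hr : 4 ≤ r) (hrn : r ≤ n / 3 + 1)
    (hindex : (SignedGraph.triangleClique n).index ≤ Γ.index) :
    Γ.HasNegativeCycle r ∨ Γ.SwitchingEquivalent (SignedGraph.triangleClique n) :=
  mainTheorem1_general Γ n r hn hΓ hr (by omega) hindex
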